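/- Let $\mathcal V$ be a finite set and let $\mathcal E\subset 2^{\mathcal V}$ contain $\emptyset$, all singletons, and with every hyperedge all of its subsets. Let $f=(f_C\colon\{0,1\}^C\to\mathbb R)_{C\in\mathcal E}$ be a pseudo-Boolean cost vector with energy $E_f(x)=\sum_{C\in\mathcal E}f_C(x_C)$, $x\in\{0,1\}^{\mathcal V}$. The full local LP (FLP) relaxation polytope $\Lambda_{\mathcal E}$ is the set of all $\mu=(\mu_C(x_C))_{C\in\mathcal E,\,x_C\in\{0,1\}^C}$ with $\mu\ge 0$, $\mu_\emptyset=1$ and $\sum_{x_{C\setminus D}}\mu_C(x_C)=\mu_D(x_D)$ for all $D\subsetneq C$ in $\mathcal E$ and all $x_D$. For a node-wise mapping $p$, i.e. $p(x)_s=p_s(x_s)$, let $([p]\mu)_C(x_C)=\sum_{x'_C:\,p_C(x'_C)=x_C}\mu_C(x'_C)$; $p$ is called FLP-improving for $f$ if $\langle f,[p]\mu\rangle\le\langle f,\mu\rangle$ for all $\mu\in\Lambda_{\mathcal E}$. Write $E_f$ as a multilinear polynomial $P$. Suppose that a polynomial $Q$ of degree at most $2$ in $0$-$1$ variables indexed by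 a finite set $\mathcal V'$, consisting of (a copy of) $\mathcal V$ and of auxiliary variables, is obtained from $P$ by a finite sequence of the following steps, in any order, where $\alpha_H$ denotes the coefficient of $\prod_{j\in H}x_j$ in the current polynomial. * Group reduction (of Fix et al.): for a non-empty family $\mathcal H$ of sets $H$ with $\alpha_H>0$ and a set $C$ contained in all $H\in\mathcal H$, replace the terms $\sum_{H\in\mathcal H}\alpha_H\prod_{j\in H}x_j$ by $$\sum_{H\in\mathcal H}\alpha_H\Big(y\prod_{j\in C}x_j+(1-y)\prod_{j\in H\setminus C}x_j\Big)$$ with one new variable $y$. * Clique reduction (the form of the reductions used in HOCR): for a set $H$ with $\alpha_H\ne 0$, replace the single term $\alpha_H\prod_{j\in H}x_j$ by a multilinear polynomial $g(x_H,y_1,\dots,y_m)$ with new variables $y_1,\dots,y_m$ such that $\alpha_H\prod_{j\in H}x_j=\min_{y\in\{0,1\}^m}g(x_H,y)$ for all $x_H\in\{0,1\}^H$. Let QPBO be applied to $Q$: let $\mu$ be an optimal solution of the FLP relaxation of the quadratic problem $Q$ (the roof dual relaxation; its hyperedges are $\emptyset$, all nodes, and the pairs with non-zero coefficient in $Q$),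 let $\mathcal A\subset\mathcal V'$ be the set of nodes $s$ for which $\mu_s$ is integer, and let $y_{\mathcal A}$ be the corresponding partial assignment, $\mu_s(y_s)=1$ for $s\in\mathcal A$. Then the mapping of the original problem that corresponds to this persistency, the overwrite mapping $x\mapsto x[\mathcal A\cap\mathcal V\leftarrow y]$ on $\{0,1\}^{\mathcal V}$, is FLP-improving for $f$. -/

import Mathlib

universe u

namespace PseudoBoolean

/-! ## Energies, the full local LP relaxation and relaxed-improving maps -/

/-- Vectors of `ℝ^I`, where `I = {(C, x_C) | C ∈ E, x_C ∈ {0,1}^C}`.  Both cost vectors `f` and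
relaxed labelings `μ` are such vectors. -/
abbrev IndexedVec {V : Type u} (E : Finset (Finset V)) : Type u :=
  (C : {C : Finset V // C ∈ E}) → ({s : V // s ∈ C.1} → Bool) → ℝ

/-- The energy `E_f(x) = ∑_{C ∈ E} f_C(x_C)` of a labeling `x`. -/
noncomputable def energy {V : Type u} {E : Finset (Finset V)} (f : IndexedVec E)
    (x : V → Bool) : ℝ :=
  ∑ C : {C : Finset V // C ∈ E}, f C (fun s => x s.1)

/-- The scalar product of `ℝ^I`. -/
noncomputable def scalarProd {V : Type u} [DecidableEq V] {E : Finset (Finset V)} (f μ : IndexedVec E) : ℝ :=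
  ∑ C : {C : Finset V // C ∈ E}, ∑ xC : {s : V // s ∈ C.1} → Bool, f C xC * μ C xC

/-- The full local LP (FLP) relaxation polytope of the hypergraph `E`: nonnegativity,
`μ_∅ = 1`, and all marginalization constraints
`∑_{x_{C \ D}} μ_C(x_C) = μ_D(x_D)` for `D ⊊ C`, `C, D ∈ E`. -/
def flp {V : Type u} [DecidableEq V] (E : Finset (Finset V)) : Set (IndexedVec E) :=
  {μ | (∀ C xC, 0 ≤ μ C xC) ∧
    (∀ C, C.1 = ∅ → ∀ xC, μ C xC = 1) ∧
    (∀ (C D : {C : Finset V // C ∈ E}) (h : D.1 ⊂ C.1) (xD : {s : V // s ∈ D.1} → Bool),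
      (∑ xC : {s : V // s ∈ C.1} → Bool,
        if (∀ s : {s : V // s ∈ D.1}, xC ⟨s.1, h.1 s.2⟩ = xD s) then μ C xC else 0) = μ D xD)}

/-- The linear extension `[p]` of a node-wise mapping `p`, given by
`([p] μ)_C(x_C) = ∑_{x'_C} ⟦p_C(x'_C) = x_C⟧ μ_C(x'_C)`. -/
noncomputable def linExt {V : Type u} [DecidableEq V] {E : Finset (Finset V)} (p : V → Bool → Bool)
    (μ : IndexedVec E) : IndexedVec E :=
  fun C xC => ∑ xC' : {s : V // s ∈ C.1} → Bool,
    if (∀ s, p s.1 (xC' s) = xC s) then μ C xC' else 0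

/-- The node-wise mapping `p` (more precisely `[p]`) is FLP-improving for `f`. -/
def IsFLPImproving {V : Type u} [DecidableEq V] {E : Finset (Finset V)} (f : IndexedVec E)
    (p : V → Bool → Bool) : Prop :=
  ∀ μ ∈ flp E, scalarProd f (linExt p μ) ≤ scalarProd f μ

/-- The node-wise mapping `x ↦ x[A ← y]` of a partial assignment `y`, where `A` is the set of
nodes `s` with `y s ≠ none`. -/
def overwrite {V : Type u} (y : V → Option Bool) : V → Bool → Bool :=
  fun s b => (y s).getD b

/-! ## Multilinear polynomials and the reductions -/

/-- The `0`-`1` vector of a Boolean assignment. -/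
def boolVec {N : Type u} (x : N → Bool) : N → ℝ := fun i => if x i then 1 else 0

/-- The exponent of the square-free monomial `∏_{j ∈ H} x_j`. -/
noncomputable def setExp {N : Type u} (H : Finset N) : N →₀ ℕ := ∑ j ∈ H, Finsupp.single j 1

/-- The coefficient `α_H` of `∏_{j ∈ H} x_j` in `P`. -/
noncomputable def setCoeff {N : Type u} (P : MvPolynomial N ℝ) (H : Finset N) : ℝ :=
  MvPolynomial.coeff (setExp H) P

/-- The group reduction: the positive terms `α_H ∏_{j ∈ H} x_j`, `H ∈ G`, all of which contain
the common part `C`, are replaced by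
`∑_{H ∈ G} α_H (y ∏_{j ∈ C} x_j + (1 - y) ∏_{j ∈ H \ C} x_j)`
with one new variable `y = X none`. -/
noncomputable def groupReduced {N : Type u} [DecidableEq N] (P : MvPolynomial N ℝ)
    (G : Finset (Finset N)) (C : Finset N) : MvPolynomial (Option N) ℝ :=
  MvPolynomial.rename some
      (P - ∑ H ∈ G, MvPolynomial.C (setCoeff P H) * ∏ j ∈ H, MvPolynomial.X j) +
    ∑ H ∈ G, MvPolynomial.C (setCoeff P H) *
      (MvPolynomial.X none * ∏ j ∈ C, MvPolynomial.X (some j) +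
        (1 - MvPolynomial.X none) * ∏ j ∈ H \ C, MvPolynomial.X (some j))

/-- The reduction of a single clique: the term `α_H ∏_{j ∈ H} x_j` is replaced by `g(x_H, y)`
with new variables `y = (y_1, …, y_m)`. -/
noncomputable def cliqueReduced {N : Type u} {m : ℕ} (P : MvPolynomial N ℝ) (H : Finset N)
    (g : MvPolynomial (N ⊕ Fin m) ℝ) : MvPolynomial (N ⊕ Fin m) ℝ :=
  MvPolynomial.rename Sum.inl
      (P - MvPolynomial.C (setCoeff P H) * ∏ j ∈ H, MvPolynomial.X j) + g

/-- `g` is a multilinear polynomial in `x_H` and the new variables `y` with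
`α_H ∏_{j ∈ H} x_j = min_y g(x_H, y)` for all `x`. -/
def IsCliqueReduction {N : Type u} {m : ℕ} (P : MvPolynomial N ℝ) (H : Finset N)
    (g : MvPolynomial (N ⊕ Fin m) ℝ) : Prop :=
  g ∈ MvPolynomial.restrictDegree (N ⊕ Fin m) ℝ 1 ∧
  (∀ i : N, Sum.inl i ∈ g.vars → i ∈ H) ∧
  ∀ x : N → Bool,
    IsLeast (Set.range fun y : Fin m → Bool => MvPolynomial.eval (boolVec (Sum.elim x y)) g)
      (setCoeff P H * ∏ j ∈ H, boolVec x j)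

/-- `Reduces P N ι Q`: the polynomial `Q` in the variables `N` is obtained from the polynomial
`P` in the variables `V` by finitely many group reductions and clique reductions, applied in any
order; `ι : V → N` says which variables of `Q` are the initial ones. -/
inductive Reduces {V : Type u} (P : MvPolynomial V ℝ) :
    (N : Type u) → (V → N) → MvPolynomial N ℝ → Prop
  | refl : Reduces P V id P
  | group {N : Type u} [DecidableEq N] {ι : V → N} {Q : MvPolynomial N ℝ}
      (hQ : Reduces P N ι Q) (G : Finset (Finset N)) (hG : G.Nonempty) (C : Finset N)
      (hC : ∀ H ∈ G, C ⊆ H) (hpos : ∀ H ∈ G, 0 < setCoeff Q H) :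
      Reduces P (Option N) (fun s => some (ι s)) (groupReduced Q G C)
  | clique {N : Type u} {ι : V → N} {Q : MvPolynomial N ℝ}
      (hQ : Reduces P N ι Q) (H : Finset N) (hH : setCoeff Q H ≠ 0) {m : ℕ}
      (g : MvPolynomial (N ⊕ Fin m) ℝ) (hg : IsCliqueReduction Q H g) :
      Reduces P (N ⊕ Fin m) (fun s => Sum.inl (ι s)) (cliqueReduced Q H g)

/-! ## QPBO -/

/-- The hypergraph of a quadratic polynomial: the empty set, all nodes, and the supports of the
terms of `Q`. -/
noncomputable def termEdges {N : Type u} [Fintype N] (Q : MvPolynomial N ℝ) :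
    Finset (Finset N) :=
  open Classical in {C | C.card ≤ 1 ∨ setCoeff Q C ≠ 0}

theorem singleton_mem_termEdges {N : Type u} [Fintype N] (Q : MvPolynomial N ℝ) (s : N) :
    {s} ∈ termEdges Q := by
  simp [termEdges]

/-- The cost vector of a multilinear polynomial, `q_C(x_C) = α_C ∏_{s ∈ C} x_s`. -/
noncomputable def termCost {N : Type u} [Fintype N] (Q : MvPolynomial N ℝ) :
    IndexedVec (termEdges Q) :=
  fun C xC => setCoeff Q C.1 * ∏ s, boolVec xC s

/-- `y` is a partial assignment found by QPBO for the quadratic polynomial `Q`: it is the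
integral part of an optimal solution `μ` of the roof dual relaxation (the FLP relaxation of the
quadratic problem), `y s = none` meaning that `μ_s` is fractional. -/
def IsQPBOPersistency {N : Type u} [Fintype N] [DecidableEq N] (Q : MvPolynomial N ℝ)
    (y : N → Option Bool) : Prop :=
  ∃ μ ∈ flp (termEdges Q),
    (∀ ν ∈ flp (termEdges Q), scalarProd (termCost Q) μ ≤ scalarProd (termCost Q) ν) ∧
    ∀ (s : N) (b : Bool),
      y s = some b ↔ μ ⟨{s}, singleton_mem_termEdges Q s⟩ (fun _ => b) = 1

end PseudoBoolean

/-! A relaxed labeling `μ` is encoded by its moments `m D = μ_D(1,…,1)`, and cost becomes a linear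
functional on polynomials, `pseudoExp m`. The moments are locally consistent: on each hyperedge they
come from a genuine probability distribution, so a pointwise fact about 0-1 points, used within one
hyperedge, passes to `pseudoExp`.

Each reduction step extends the moments to the new variables (`IsReduction.clique`,
`IsReduction.group`). At every sample point the new variables take minimizing values, so the cost is
unchanged. After overwriting by any `y`, the new variables need no longer be minimizing, but the
replacement still bounds the replaced term from above, so the overwritten cost can only grow from
`P` to `Q`.

For the quadratic `Q`, overwriting by the integral part of an optimal roof dual solution does not
increase the cost of any locally consistent moments (`IsQPBOPersistency.pseudoExp_le`): going from
the overwritten to the original labeling is a feasible direction at the optimum, since an edge of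
size at most two that meets the integral part has at most one fractional node.

Together: overwritten `P` ≤ overwritten `Q` ≤ `Q` = `P`. -/

namespace PseudoBoolean

open MvPolynomial

/-! ## Pseudo-expectations -/

section Moments

variable {N : Type u}

/-- The linear functional on polynomials whose value at every monomial with set of variables `D`
is the moment `m D`. -/
noncomputable def pseudoExp (m : Finset N → ℝ) : MvPolynomial N ℝ →ₗ[ℝ] ℝ :=
  (basisMonomials N ℝ).constr ℝ fun e => m e.support

theorem pseudoExp_monomial (m : Finset N → ℝ) (e : N →₀ ℕ) (c : ℝ) :
    pseudoExp m (monomial e c) = c * m e.support := by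
  have h : (monomial e c : MvPolynomial N ℝ) = c • basisMonomials N ℝ e := by
    simp [smul_monomial]
  rw [h, map_smul, pseudoExp, Module.Basis.constr_basis, smul_eq_mul]

theorem support_setExp (H : Finset N) : (setExp H).support = H := by
  classical
  ext i
  simp [setExp, Finsupp.finsetSum_apply, Finsupp.single_apply]

theorem setExp_apply [DecidableEq N] (H : Finset N) (i : N) :
    setExp H i = if i ∈ H then 1 else 0 := by
  simp [setExp, Finsupp.finsetSum_apply, Finsupp.single_apply]

theorem prod_X_eq_monomial (H : Finset N) :
    ∏ j ∈ H, (X j : MvPolynomial N ℝ) = monomial (setExp H) 1 := by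
  rw [setExp, monomial_sum_one]
  rfl

theorem pseudoExp_prod_X (m : Finset N → ℝ) (H : Finset N) :
    pseudoExp m (∏ j ∈ H, X j) = m H := by
  rw [prod_X_eq_monomial, pseudoExp_monomial, support_setExp, one_mul]

/-- On the subsets of `C`, the moments `m` are those of the probability weights `w` on the points
`x`. -/
structure IsMomentsOn {Ω : Type u} [Fintype Ω] (m : Finset N → ℝ) (C : Finset N) (w : Ω → ℝ)
    (x : Ω → N → Bool) : Prop where
  nonneg : ∀ i, 0 ≤ w i
  sum_eq_one : ∑ i, w i = 1
  moment : ∀ D ⊆ C, m D = ∑ i, w i * ∏ j ∈ D, boolVec (x i) j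

/-- The moments `m` are locally, on each member of `E`, those of a probability distribution. -/
def LocallyConsistent (E : Set (Finset N)) (m : Finset N → ℝ) : Prop :=
  ∀ C ∈ E, ∃ (Ω : Type u) (_ : Fintype Ω) (w : Ω → ℝ) (x : Ω → N → Bool), IsMomentsOn m C w x

theorem boolVec_pow (x : N → Bool) (i : N) {k : ℕ} (hk : k ≠ 0) :
    boolVec x i ^ k = boolVec x i := by
  unfold boolVec
  split_ifs <;> simp [hk]

theorem boolVec_nonneg (x : N → Bool) (i : N) : 0 ≤ boolVec x i := by
  unfold boolVec
  split_ifs <;> simp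

theorem prod_boolVec_eq_ite (x : N → Bool) (D : Finset N) [Decidable (∀ j ∈ D, x j = true)] :
    ∏ j ∈ D, boolVec x j = if ∀ j ∈ D, x j = true then 1 else 0 := by
  split_ifs with h
  · exact Finset.prod_eq_one fun j hj => by simp [boolVec, h j hj]
  · push Not at h
    obtain ⟨j, hj, hx⟩ := h
    exact Finset.prod_eq_zero hj (by simp [boolVec, hx])

/-- Powers collapse at 0-1 points, matching the fact that `pseudoExp` sees only the support of an
exponent; multilinearity of `p` is not needed. -/
theorem IsMomentsOn.pseudoExp_eq {Ω : Type u} [Fintype Ω] {m : Finset N → ℝ} {C : Finset N}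
    {w : Ω → ℝ} {x : Ω → N → Bool} (h : IsMomentsOn m C w x) {p : MvPolynomial N ℝ}
    (hp : p.vars ⊆ C) : pseudoExp m p = ∑ i, w i * eval (boolVec (x i)) p := by
  conv_lhs => rw [p.as_sum]
  simp only [map_sum, pseudoExp_monomial, eval_eq, Finset.mul_sum]
  rw [Finset.sum_comm]
  refine Finset.sum_congr rfl fun e he => ?_
  rw [h.moment _
    (fun _ hj => hp ((mem_vars_iff_mem_support _).2 ⟨e, he, hj⟩)), Finset.mul_sum]
  refine Finset.sum_congr rfl fun i _ => ?_
  rw [Finset.prod_congr rfl fun j hj => boolVec_pow (x i) j (Finsupp.mem_support_iff.1 hj)]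
  ring

open Classical in
/-- The moments of the points overwritten by the partial assignment `y`. -/
noncomputable def overwriteMoments (y : N → Option Bool) (m : Finset N → ℝ) (D : Finset N) : ℝ :=
  if ∃ j ∈ D, y j = some false then 0 else m {j ∈ D | y j = none}

/-- Weights stay and points are overwritten: a node fixed to `false` kills the product, one fixed to
`true` drops out of it. The resulting moments mention neither `w` nor `x`, so one moment function
serves all hyperedges. -/
theorem IsMomentsOn.overwrite {Ω : Type u} [Fintype Ω] {m : Finset N → ℝ} {C : Finset N}
    {w : Ω → ℝ} {x : Ω → N → Bool} (h : IsMomentsOn m C w x) (y : N → Option Bool) :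
    IsMomentsOn (overwriteMoments y m) C w fun i j => overwrite y j (x i j) := by
  classical
  refine ⟨h.nonneg, h.sum_eq_one, fun D hD => ?_⟩
  unfold overwriteMoments
  split_ifs with hy
  · obtain ⟨j, hj, hyj⟩ := hy
    refine (Finset.sum_eq_zero fun i _ => ?_).symm
    rw [Finset.prod_eq_zero hj, mul_zero]
    simp [boolVec, PseudoBoolean.overwrite, hyj]
  · rw [h.moment _ ((Finset.filter_subset _ D).trans hD)]
    refine Finset.sum_congr rfl fun i _ => ?_
    rw [Finset.prod_filter]
    congr 1
    refine Finset.prod_congr rfl fun j hj => ?_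
    push Not at hy
    have := hy j hj
    rcases hyj : y j with _ | _ | _ <;> simp_all [boolVec, PseudoBoolean.overwrite]

theorem LocallyConsistent.overwrite {E : Set (Finset N)} {m : Finset N → ℝ}
    (h : LocallyConsistent E m) (y : N → Option Bool) :
    LocallyConsistent E (overwriteMoments y m) := fun C hC => by
  obtain ⟨Ω, _, w, x, hm⟩ := h C hC
  exact ⟨Ω, _, w, _, hm.overwrite y⟩

theorem pseudoExp_rename {M : Type u} (φ : N ↪ M) {m : Finset N → ℝ} {m' : Finset M → ℝ}
    (h : ∀ D, m' (D.map φ) = m D) (p : MvPolynomial N ℝ) :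
    pseudoExp m' (rename φ p) = pseudoExp m p := by
  classical
  induction p using MvPolynomial.induction_on' with
  | monomial e c =>
    rw [rename_monomial, pseudoExp_monomial, pseudoExp_monomial,
      Finsupp.mapDomain_support_of_injective φ.injective, ← h, Finset.map_eq_image]
  | add p q hp hq => simp [hp, hq]

theorem overwriteMoments_map {M : Type u} (φ : N ↪ M) {m : Finset N → ℝ} {m' : Finset M → ℝ}
    (h : ∀ D, m' (D.map φ) = m D) (y : M → Option Bool) (D : Finset N) :
    overwriteMoments y m' (D.map φ) = overwriteMoments (fun s => y (φ s)) m D := by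
  classical
  simp only [overwriteMoments, Finset.mem_map, exists_exists_and_eq_and, Finset.filter_map, h]
  rfl

/-- The polynomials all of whose monomials have their set of variables in `E`. -/
def supportedOn (E : Set (Finset N)) : Submodule ℝ (MvPolynomial N ℝ) where
  carrier := {p | ∀ e, coeff e p ≠ 0 → e.support ∈ E}
  zero_mem' := by simp
  add_mem' {p q} hp hq e he := by
    by_cases h : coeff e p = 0
    · exact hq e fun h' => he (by rw [coeff_add, h, h', add_zero])
    · exact hp e h
  smul_mem' c p hp e he := hp e fun h => he (by rw [coeff_smul, h, smul_zero])

theorem mem_supportedOn_of_vars_subset {E : Set (Finset N)} {C : Finset N}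
    (hE : ∀ D ⊆ C, D ∈ E) {p : MvPolynomial N ℝ} (hp : p.vars ⊆ C) : p ∈ supportedOn E :=
  fun e he => hE _
    fun _ hj => hp ((mem_vars_iff_mem_support _).2 ⟨e, mem_support_iff.2 he, hj⟩)

theorem rename_mem_supportedOn {M : Type u} (φ : N ↪ M) {E : Set (Finset N)}
    {E' : Set (Finset M)} (hE : ∀ C ∈ E, C.map φ ∈ E') {p : MvPolynomial N ℝ}
    (hp : p ∈ supportedOn E) : rename φ p ∈ supportedOn E' := by
  classical
  intro e he
  obtain ⟨d, rfl, hd⟩ := coeff_rename_ne_zero _ _ _ he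
  rw [Finsupp.mapDomain_support_of_injective φ.injective, ← Finset.map_eq_image]
  exact hE _ (hp d hd)

theorem mem_of_setCoeff_ne_zero {E : Set (Finset N)} {p : MvPolynomial N ℝ}
    (hp : p ∈ supportedOn E) {H : Finset N} (hH : setCoeff p H ≠ 0) : H ∈ E := by
  simpa [support_setExp] using hp _ hH

theorem C_mul_prod_X_mem_supportedOn {E : Set (Finset N)} {H : Finset N} (hH : H ∈ E) (c : ℝ) :
    C c * ∏ j ∈ H, X j ∈ supportedOn E := by
  classical
  rw [prod_X_eq_monomial, C_mul_monomial]
  intro e he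
  rw [coeff_monomial] at he
  obtain rfl : setExp H = e := by
    by_contra h
    simp [h] at he
  rwa [support_setExp]

/-! ## Multilinear polynomials -/

theorem mem_restrictDegree_one_iff {p : MvPolynomial N ℝ} :
    p ∈ restrictDegree N ℝ 1 ↔ ∀ i, degreeOf i p ≤ 1 := by
  simp only [mem_restrictDegree, degreeOf_le_iff]
  exact ⟨fun h i e he => h e he i, fun h e he i => h i e he⟩

theorem mul_mem_restrictDegree_one {p q : MvPolynomial N ℝ} (hp : p ∈ restrictDegree N ℝ 1)
    (hq : q ∈ restrictDegree N ℝ 1) (h : Disjoint p.vars q.vars) :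
    p * q ∈ restrictDegree N ℝ 1 := by
  rw [mem_restrictDegree_one_iff] at *
  intro i
  have := degreeOf_mul_le i p q
  have h1 := hp i
  have h2 := hq i
  have h3 : degreeOf i p = 0 ∨ degreeOf i q = 0 := by
    by_contra hc
    push Not at hc
    exact Finset.disjoint_left.1 h (mem_vars_iff_degreeOf_ne_zero.2 hc.1)
      (mem_vars_iff_degreeOf_ne_zero.2 hc.2)
  omega

theorem C_mul_mem_restrictDegree_one {p : MvPolynomial N ℝ} (hp : p ∈ restrictDegree N ℝ 1)
    (c : ℝ) : C c * p ∈ restrictDegree N ℝ 1 := by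
  rw [C_mul']
  exact Submodule.smul_mem _ _ hp

theorem X_mem_restrictDegree_one (i : N) : (X i : MvPolynomial N ℝ) ∈ restrictDegree N ℝ 1 := by
  classical
  rw [mem_restrictDegree_one_iff]
  intro j
  rw [degreeOf_X]
  split_ifs <;> simp

theorem one_mem_restrictDegree_one : (1 : MvPolynomial N ℝ) ∈ restrictDegree N ℝ 1 := by
  rw [mem_restrictDegree_one_iff]
  simp

theorem prod_mem_restrictDegree_one {κ : Type*} (s : Finset κ) (p : κ → MvPolynomial N ℝ)
    (hp : ∀ k ∈ s, p k ∈ restrictDegree N ℝ 1)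
    (hd : (s : Set κ).PairwiseDisjoint fun k => (p k).vars) :
    ∏ k ∈ s, p k ∈ restrictDegree N ℝ 1 := by
  classical
  induction s using Finset.induction_on with
  | empty => simpa using one_mem_restrictDegree_one
  | insert a s ha ih =>
    rw [Finset.prod_insert ha]
    refine mul_mem_restrictDegree_one (hp _ (by simp)) (ih (fun k hk => hp k (by simp [hk]))
      (hd.subset (by simp))) ?_
    refine Disjoint.mono_right (vars_prod p) ?_
    rw [Finset.disjoint_biUnion_right]
    intro k hk
    exact hd (by simp) (by simp [hk]) (by rintro rfl; exact ha hk)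

theorem rename_mem_restrictDegree_one {M : Type u} {φ : N → M} (hφ : Function.Injective φ)
    {p : MvPolynomial N ℝ} (hp : p ∈ restrictDegree N ℝ 1) :
    rename φ p ∈ restrictDegree M ℝ 1 := by
  classical
  rw [mem_restrictDegree] at *
  intro e he i
  obtain ⟨d, rfl, hd⟩ := coeff_rename_ne_zero _ _ _ (mem_support_iff.1 he)
  by_cases hi : i ∈ Set.range φ
  · obtain ⟨j, rfl⟩ := hi
    rw [Finsupp.mapDomain_apply hφ]
    exact hp d (mem_support_iff.2 hd) j
  · rw [Finsupp.mapDomain_of_notMem_range _ _ hi]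
    exact Nat.zero_le _

theorem prod_X_mem_restrictDegree_one {κ : Type*} (s : Finset κ) {φ : κ → N}
    (hφ : Function.Injective φ) :
    ∏ k ∈ s, (X (φ k) : MvPolynomial N ℝ) ∈ restrictDegree N ℝ 1 :=
  prod_mem_restrictDegree_one s _ (fun k _ => X_mem_restrictDegree_one _) fun a _ b _ hab => by
    simpa [Function.onFun, vars_X] using fun h => hab (hφ h)

/-- A polynomial of degree at most one in each variable is determined by its values on the grid
`{0,1}^N`. This is what allows `P` to be replaced by the indicator expansion of `f`. -/
theorem eq_of_eval_boolVec_eq [Finite N] {p q : MvPolynomial N ℝ} (hp : p ∈ restrictDegree N ℝ 1)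
    (hq : q ∈ restrictDegree N ℝ 1)
    (h : ∀ x : N → Bool, eval (boolVec x) p = eval (boolVec x) q) : p = q := by
  classical
  rw [← sub_eq_zero]
  have hd := mem_restrictDegree_one_iff.1 (Submodule.sub_mem _ hp hq)
  refine eq_zero_of_eval_zero_at_prod_finset (p - q) (fun _ => {0, 1}) (fun i => ?_) fun z hz => ?_
  · rw [Finset.card_pair zero_ne_one]
    exact Nat.lt_succ_of_le (hd i)
  · have hz' : z = boolVec fun i => decide (z i = 1) := by
      funext i
      have := hz i
      simp only [Finset.mem_insert, Finset.mem_singleton] at this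
      rcases this with h0 | h0 <;> simp [boolVec, h0]
    rw [hz', map_sub, h, sub_self]

end Moments

end PseudoBoolean

namespace PseudoBoolean

open MvPolynomial

/-! ## Reductions of pseudo-expectations -/

section Reductions

variable {N : Type u}

/-- A downward closed set of finite sets that contains `∅` and the singletons. -/
structure IsHypergraph (E : Set (Finset N)) : Prop where
  empty : ∅ ∈ E
  mono : ∀ C ∈ E, ∀ D ⊆ C, D ∈ E
  singleton : ∀ s, {s} ∈ E

/-! ### Extending moments along a clique reduction -/

/-- The moments of the new variables of a clique reduction of `H`, where the sample point `x i` is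
extended by `z i`. -/
noncomputable def cliqueMoments {Ω : Type u} [Fintype Ω] {k : ℕ} (m : Finset N → ℝ) (w : Ω → ℝ)
    (x : Ω → N → Bool) (z : Ω → Fin k → Bool) (D : Finset (N ⊕ Fin k)) : ℝ :=
  if D.toRight = ∅ then m D.toLeft
  else ∑ i, w i * ∏ j ∈ D, boolVec (Sum.elim (x i) (z i)) j

/-- The hypergraph obtained from `E` by joining `k` new variables to `H`. -/
def cliqueEdges (E : Set (Finset N)) (H : Finset N) (k : ℕ) : Set (Finset (N ⊕ Fin k)) :=
  {D | D.toRight = ∅ ∧ D.toLeft ∈ E ∨ D.toLeft ⊆ H}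

theorem IsHypergraph.cliqueEdges {E : Set (Finset N)} (hE : IsHypergraph E) (H : Finset N)
    (k : ℕ) : IsHypergraph (cliqueEdges E H k) := by
  refine ⟨Or.inr fun a ha => by simp at ha, ?_, ?_⟩
  · rintro C (⟨h1, h2⟩ | h) D hD
    · exact Or.inl ⟨Finset.subset_empty.1 (h1 ▸ Finset.toRight_subset_toRight hD),
        hE.mono _ h2 _ (Finset.toLeft_subset_toLeft hD)⟩
    · exact Or.inr ((Finset.toLeft_subset_toLeft hD).trans h)
  · rintro (s | s)
    · refine Or.inl ⟨by ext; simp, ?_⟩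
      have : ({Sum.inl s} : Finset (N ⊕ Fin k)).toLeft = {s} := by ext; simp
      rw [this]
      exact hE.singleton s
    · refine Or.inr fun a ha => ?_
      simp at ha

theorem cliqueMoments_map_inl {Ω : Type u} [Fintype Ω] {k : ℕ} (m : Finset N → ℝ) (w : Ω → ℝ)
    (x : Ω → N → Bool) (z : Ω → Fin k → Bool) (D : Finset N) :
    cliqueMoments m w x z (D.map Function.Embedding.inl) = m D := by
  have h1 : (D.map (Function.Embedding.inl : N ↪ N ⊕ Fin k)).toRight = ∅ := by ext; simp
  have h2 : (D.map (Function.Embedding.inl : N ↪ N ⊕ Fin k)).toLeft = D := by ext; simp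
  rw [cliqueMoments, if_pos h1, h2]

theorem eq_map_inl_of_toRight_eq_empty {k : ℕ} {D : Finset (N ⊕ Fin k)} (h : D.toRight = ∅) :
    D = D.toLeft.map Function.Embedding.inl := by
  rw [← Finset.disjSum_empty, ← h, Finset.toLeft_disjSum_toRight]

/-- On subsets of `H` the two branches of `cliqueMoments` agree; the first is needed for sets of old
variables outside `H`, which the samples do not describe. -/
theorem IsMomentsOn.cliqueMoments {Ω : Type u} [Fintype Ω] {k : ℕ} {m : Finset N → ℝ}
    {H : Finset N} {w : Ω → ℝ} {x : Ω → N → Bool} (h : IsMomentsOn m H w x)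
    (z : Ω → Fin k → Bool) {C : Finset (N ⊕ Fin k)} (hC : C.toLeft ⊆ H) :
    IsMomentsOn (cliqueMoments m w x z) C w fun i => Sum.elim (x i) (z i) := by
  refine ⟨h.nonneg, h.sum_eq_one, fun D hD => ?_⟩
  rw [PseudoBoolean.cliqueMoments]
  split_ifs with hr
  · rw [h.moment _ ((Finset.toLeft_subset_toLeft hD).trans hC)]
    conv_rhs => rw [eq_map_inl_of_toRight_eq_empty hr]
    simp [boolVec]
  · rfl

theorem LocallyConsistent.cliqueMoments {Ω : Type u} [Fintype Ω] {k : ℕ} {m : Finset N → ℝ}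
    {E : Set (Finset N)} {H : Finset N} {w : Ω → ℝ} {x : Ω → N → Bool}
    (hm : LocallyConsistent E m) (h : IsMomentsOn m H w x) (z : Ω → Fin k → Bool) :
    LocallyConsistent (cliqueEdges E H k) (cliqueMoments m w x z) := by
  rintro C (⟨h1, h2⟩ | hC)
  · obtain ⟨Ω', _, w', x', h'⟩ := hm _ h2
    -- No new variable occurs in `C`, so the value `false` is arbitrary.
    refine ⟨Ω', _, w', fun i => Sum.elim (x' i) fun _ => false, h'.nonneg, h'.sum_eq_one,
      fun D hD => ?_⟩
    have hr : D.toRight = ∅ := Finset.subset_empty.1 (h1 ▸ Finset.toRight_subset_toRight hD)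
    rw [eq_map_inl_of_toRight_eq_empty hr, cliqueMoments_map_inl,
      h'.moment _ (Finset.toLeft_subset_toLeft hD)]
    simp [boolVec]
  · exact ⟨Ω, _, w, _, h.cliqueMoments z hC⟩

/-! ### Extending moments along a group reduction -/

/-- The group reduction of `∏_{j ∈ H} x_j` with common part `C`. -/
noncomputable def groupTerm [DecidableEq N] (C H : Finset N) : MvPolynomial (Option N) ℝ :=
  X none * ∏ j ∈ C, X (some j) + (1 - X none) * ∏ j ∈ H \ C, X (some j)

theorem vars_groupTerm_subset [DecidableEq N] {C H : Finset N} (hC : C ⊆ H) :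
    (groupTerm C H).vars ⊆ Finset.insertNone H := by
  have hp : ∀ D ⊆ H, (∏ j ∈ D, X (some j) : MvPolynomial (Option N) ℝ).vars
      ⊆ Finset.insertNone H := fun D hD => by
    refine (vars_prod _).trans (Finset.biUnion_subset.2 fun j hj => ?_)
    simpa [vars_X] using hD hj
  have hn : (X none : MvPolynomial (Option N) ℝ).vars ⊆ Finset.insertNone H := by
    simp [vars_X]
  refine (vars_add_subset _ _).trans (Finset.union_subset ?_ ?_)
  · exact (vars_mul _ _).trans (Finset.union_subset hn (hp _ hC))
  · refine (vars_mul _ _).trans (Finset.union_subset ?_ (hp _ Finset.sdiff_subset))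
    exact (vars_sub_subset _).trans (Finset.union_subset (by simp) hn)

theorem groupTerm_mem_restrictDegree_one [DecidableEq N] (C H : Finset N) :
    groupTerm C H ∈ restrictDegree (Option N) ℝ 1 := by
  have hd : ∀ (p : MvPolynomial (Option N) ℝ) (D : Finset N), p.vars ⊆ {none} →
      Disjoint p.vars (∏ j ∈ D, X (some j) : MvPolynomial (Option N) ℝ).vars := fun p D hp => by
    refine Disjoint.mono hp (vars_prod _) ?_
    simp [vars_X]
  refine Submodule.add_mem _ (mul_mem_restrictDegree_one (X_mem_restrictDegree_one _)
    (prod_X_mem_restrictDegree_one _ (Option.some_injective N)) (hd _ _ (by simp [vars_X])))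
    (mul_mem_restrictDegree_one (Submodule.sub_mem _ one_mem_restrictDegree_one
      (X_mem_restrictDegree_one _)) (prod_X_mem_restrictDegree_one _ (Option.some_injective N))
      (hd _ _ ((vars_sub_subset _).trans (by simp [vars_X]))))

theorem eval_groupTerm [DecidableEq N] (C H : Finset N) (x : Option N → Bool) :
    eval (boolVec x) (groupTerm C H) = boolVec x none * ∏ j ∈ C, boolVec x (some j) +
      (1 - boolVec x none) * ∏ j ∈ H \ C, boolVec x (some j) := by
  simp [groupTerm]

/-- Either value of the new variable leaves a product over a subset of `H`, and dropping factors
from `[0,1]` does not decrease a product. -/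
theorem prod_le_eval_groupTerm [DecidableEq N] {C H : Finset N} (hC : C ⊆ H)
    (x : Option N → Bool) :
    ∏ j ∈ H, boolVec x (some j) ≤ eval (boolVec x) (groupTerm C H) := by
  rw [eval_groupTerm, ← Finset.prod_sdiff hC]
  have h01 : ∀ D : Finset N, 0 ≤ ∏ j ∈ D, boolVec x (some j) ∧
      ∏ j ∈ D, boolVec x (some j) ≤ 1 := fun D =>
    ⟨Finset.prod_nonneg fun j _ => boolVec_nonneg x _, Finset.prod_le_one
      (fun j _ => boolVec_nonneg x _) fun j _ => by unfold boolVec; split_ifs <;> simp⟩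
  have h1 := h01 C
  have h2 := h01 (H \ C)
  rcases hx : x none with _ | _
  · simp only [boolVec, hx] at *
    simp only [Bool.false_eq_true, if_false]
    nlinarith
  · simp only [boolVec, hx] at *
    simp only [if_true]
    nlinarith

open Classical in
/-- The extension of a `0`-`1` vector by the complement of `∏_{j ∈ C} x_j`. -/
noncomputable def groupPoint (C : Finset N) (x : N → Bool) : Option N → Bool
  | none => !decide (∀ j ∈ C, x j = true)
  | some j => x j

theorem boolVec_groupPoint_none (C : Finset N) (x : N → Bool) :
    boolVec (groupPoint C x) none = 1 - ∏ j ∈ C, boolVec x j := by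
  classical
  rw [prod_boolVec_eq_ite]
  by_cases h : ∀ j ∈ C, x j = true
  · rw [if_pos h]
    simpa [boolVec, groupPoint] using h
  · rw [if_neg h]
    simpa [boolVec, groupPoint] using h

theorem boolVec_groupPoint_some (C : Finset N) (x : N → Bool) (j : N) :
    boolVec (groupPoint C x) (some j) = boolVec x j := rfl

/-- If `∏_C = 1`, the new variable is 0 and `∏_{H \ C}` remains; if `∏_C = 0`, it is 1 and both
sides vanish. -/
theorem eval_groupTerm_groupPoint [DecidableEq N] {C H : Finset N} (hC : C ⊆ H)
    (x : N → Bool) :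
    eval (boolVec (groupPoint C x)) (groupTerm C H) = ∏ j ∈ H, boolVec x j := by
  rw [eval_groupTerm, ← Finset.prod_sdiff hC, boolVec_groupPoint_none]
  simp only [boolVec_groupPoint_some]
  rw [prod_boolVec_eq_ite x C]
  split_ifs <;> simp

open Classical in
/-- The moments of the extension of all sample points by the complement of `∏_{j ∈ C} x_j`. -/
noncomputable def groupMoments (m : Finset N → ℝ) (C : Finset N) (D : Finset (Option N)) : ℝ :=
  if none ∈ D then m (Finset.eraseNone D) - m (Finset.eraseNone D ∪ C)
  else m (Finset.eraseNone D)

/-- The hypergraph obtained from `E` by joining a new variable to the members of `G`. -/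
def groupEdges (E : Set (Finset N)) (G : Finset (Finset N)) : Set (Finset (Option N)) :=
  {D | none ∉ D ∧ Finset.eraseNone D ∈ E ∨ ∃ H ∈ G, Finset.eraseNone D ⊆ H}

theorem IsHypergraph.groupEdges {E : Set (Finset N)} (hE : IsHypergraph E)
    {G : Finset (Finset N)} (hG : G.Nonempty) : IsHypergraph (groupEdges E G) := by
  refine ⟨Or.inr (hG.imp fun H hH => ⟨hH, by simp⟩), ?_, ?_⟩
  · rintro C (⟨h1, h2⟩ | ⟨H, hH, h⟩) D hD
    · exact Or.inl ⟨fun h => h1 (hD h), hE.mono _ h2 _ (Finset.eraseNone.monotone hD)⟩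
    · exact Or.inr ⟨H, hH, (Finset.eraseNone.monotone hD).trans h⟩
  · rintro (_ | s)
    · obtain ⟨H, hH⟩ := hG
      exact Or.inr ⟨H, hH, by simp⟩
    · refine Or.inl ⟨by simp, ?_⟩
      have : Finset.eraseNone {some s} = {s} := by ext; simp [eq_comm]
      rw [this]
      exact hE.singleton s

theorem groupMoments_map_some (m : Finset N → ℝ) (C D : Finset N) :
    groupMoments m C (D.map Function.Embedding.some) = m D := by
  rw [groupMoments, if_neg (by simp), Finset.eraseNone_map_some]

theorem eq_map_some_of_none_notMem {D : Finset (Option N)} (h : none ∉ D) :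
    D = (Finset.eraseNone D).map Function.Embedding.some := by
  classical
  rw [Finset.map_some_eraseNone, Finset.erase_eq_of_notMem h]

/-- The expectation of `(1 - ∏_C) ∏_B` is `m B - m (B ∪ C)`, by idempotence of 0-1 values. Since
this formula is independent of the sampling, a single new variable serves all members of the group,
although their local distributions may differ. -/
theorem IsMomentsOn.groupMoments {Ω : Type u} [Fintype Ω] {m : Finset N → ℝ}
    {H C : Finset N} {w : Ω → ℝ} {x : Ω → N → Bool} (h : IsMomentsOn m H w x) (hCH : C ⊆ H)
    {D : Finset (Option N)} (hD : Finset.eraseNone D ⊆ H) :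
    IsMomentsOn (groupMoments m C) D w fun i => groupPoint C (x i) := by
  classical
  refine ⟨h.nonneg, h.sum_eq_one, fun B hB => ?_⟩
  have hB' := (Finset.eraseNone.monotone hB).trans hD
  have hprod : ∀ i, ∏ j ∈ (Finset.eraseNone B).map Function.Embedding.some,
      boolVec (groupPoint C (x i)) j = ∏ j ∈ Finset.eraseNone B, boolVec (x i) j := fun i => by
    rw [Finset.prod_map]
    rfl
  rw [PseudoBoolean.groupMoments]
  split_ifs with hn
  · rw [h.moment _ hB', h.moment _ (Finset.union_subset hB' hCH), ← Finset.sum_sub_distrib]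
    refine Finset.sum_congr rfl fun i _ => ?_
    rw [← Finset.mul_prod_erase _ _ hn, ← Finset.map_some_eraseNone, hprod,
      boolVec_groupPoint_none]
    have hu : ∏ j ∈ Finset.eraseNone B ∪ C, boolVec (x i) j =
        (∏ j ∈ C, boolVec (x i) j) * ∏ j ∈ Finset.eraseNone B, boolVec (x i) j := by
      simp only [prod_boolVec_eq_ite, Finset.mem_union]
      by_cases h1 : ∀ j ∈ C, x i j = true
      · by_cases h2 : ∀ j ∈ Finset.eraseNone B, x i j = true
        · rw [if_pos h1, if_pos h2, if_pos (fun j hj => hj.elim (h2 j) (h1 j)), one_mul]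
        · rw [if_neg h2, if_neg fun h => h2 fun j hj => h j (Or.inl hj), mul_zero]
      · rw [if_neg h1, if_neg fun h => h1 fun j hj => h j (Or.inr hj), zero_mul]
    rw [hu]
    ring
  · rw [h.moment _ hB']
    conv_rhs => rw [eq_map_some_of_none_notMem hn]
    simp only [hprod]

theorem LocallyConsistent.groupMoments {m : Finset N → ℝ} {E : Set (Finset N)}
    {G : Finset (Finset N)} {C : Finset N} (hm : LocallyConsistent E m) (hC : ∀ H ∈ G, C ⊆ H)
    (hG : ∀ H ∈ G, H ∈ E) : LocallyConsistent (groupEdges E G) (groupMoments m C) := by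
  rintro D (⟨h1, h2⟩ | ⟨H, hH, hD⟩)
  · obtain ⟨Ω', _, w', x', h'⟩ := hm _ h2
    refine ⟨Ω', _, w', fun i => groupPoint C (x' i), h'.nonneg, h'.sum_eq_one, fun B hB => ?_⟩
    rw [eq_map_some_of_none_notMem fun h => h1 (hB h), groupMoments_map_some,
      h'.moment _ (Finset.eraseNone.monotone hB)]
    refine Finset.sum_congr rfl fun i _ => ?_
    rw [Finset.prod_map]
    rfl
  · obtain ⟨Ω', _, w', x', h'⟩ := hm _ (hG H hH)
    exact ⟨Ω', _, w', _, h'.groupMoments (hC H hH) hD⟩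

/-! ### Reductions preserve the value and dominate overwritten values -/

/-- `m'` is a locally consistent extension of the moments `m` for `P` to moments for `Q` that has
the same value and does not increase the value under overwriting. -/
structure IsReduction {V : Type u} (P : MvPolynomial V ℝ) (m : Finset V → ℝ) (ι : V → N)
    (Q : MvPolynomial N ℝ) (E : Set (Finset N)) (m' : Finset N → ℝ) : Prop where
  hypergraph : IsHypergraph E
  supported : Q ∈ supportedOn E
  consistent : LocallyConsistent E m'
  value_eq : pseudoExp m' Q = pseudoExp m P
  value_le : ∀ y : N → Option Bool, pseudoExp (overwriteMoments (fun s => y (ι s)) m) P ≤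
    pseudoExp (overwriteMoments y m') Q

theorem IsReduction.clique {V : Type u} {P : MvPolynomial V ℝ} {m : Finset V → ℝ} {ι : V → N}
    {Q : MvPolynomial N ℝ} {E : Set (Finset N)} {m' : Finset N → ℝ}
    (h : IsReduction P m ι Q E m') {H : Finset N} (hH : setCoeff Q H ≠ 0) {k : ℕ}
    {g : MvPolynomial (N ⊕ Fin k) ℝ} (hg : IsCliqueReduction Q H g) :
    ∃ E' m'', IsReduction P m (fun s => Sum.inl (ι s)) (cliqueReduced Q H g) E' m'' := by
  obtain ⟨-, hvars, hmin⟩ := hg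
  have hHE := mem_of_setCoeff_ne_zero h.supported hH
  obtain ⟨Ω, _, w, x, hw⟩ := h.consistent H hHE
  choose z hz using fun i => (hmin (x i)).1
  have hgv : g.vars ⊆ H.disjSum Finset.univ := by
    rintro (i | i) hi
    · simpa using hvars i hi
    · simp
  have hwg := hw.cliqueMoments z (C := H.disjSum Finset.univ) (by simp)
  have hterm : cliqueReduced Q H g = rename (Function.Embedding.inl : N ↪ N ⊕ Fin k)
      (Q - C (setCoeff Q H) * ∏ j ∈ H, X j) + g := rfl
  refine ⟨cliqueEdges E H k, cliqueMoments m' w x z, h.hypergraph.cliqueEdges H k, ?_,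
    h.consistent.cliqueMoments hw z, ?_, fun y => ?_⟩
  · rw [hterm]
    refine Submodule.add_mem _ (rename_mem_supportedOn Function.Embedding.inl (fun C hC => ?_)
      (Submodule.sub_mem _ h.supported (C_mul_prod_X_mem_supportedOn hHE _)))
      (mem_supportedOn_of_vars_subset (fun D hD => ?_) hgv)
    · have h1 : (C.map (Function.Embedding.inl : N ↪ N ⊕ Fin k)).toRight = ∅ := by ext; simp
      have h2 : (C.map (Function.Embedding.inl : N ↪ N ⊕ Fin k)).toLeft = C := by ext; simp
      exact Or.inl ⟨h1, h2.symm ▸ hC⟩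
    · exact Or.inr (Finset.subset_disjSum.1 hD).1
  -- `z i` attains the minimum of `g` at `x i`, so `g` contributes exactly what the removed term
  -- did.
  · rw [hterm, map_add, hwg.pseudoExp_eq hgv, pseudoExp_rename _ (cliqueMoments_map_inl m' w x z)]
    simp only [hz, map_sub, C_mul', map_smul, pseudoExp_prod_X, h.value_eq, smul_eq_mul,
      hw.moment H subset_rfl, Finset.mul_sum]
    rw [sub_add, sub_eq_self, sub_eq_zero]
    exact Finset.sum_congr rfl fun i _ => by ring
  · refine (h.value_le fun s => y (Function.Embedding.inl s)).trans ?_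
    rw [hterm, map_add, (hwg.overwrite y).pseudoExp_eq hgv, pseudoExp_rename _
      (overwriteMoments_map Function.Embedding.inl (cliqueMoments_map_inl m' w x z) y)]
    simp only [map_sub, C_mul', map_smul, pseudoExp_prod_X, smul_eq_mul]
    rw [(hw.overwrite fun s => y (Function.Embedding.inl s)).moment H subset_rfl]
    rw [sub_add, le_sub_self_iff, sub_nonpos, Finset.mul_sum]
    refine Finset.sum_le_sum fun i _ => ?_
    rw [mul_left_comm]
    -- The overwritten `z i` is some value of the new variables, hence an upper bound for the
    -- minimum at the overwritten `x i`.
    refine mul_le_mul_of_nonneg_left ((hmin _).2 ⟨fun j => overwrite y (Sum.inr j) (z i j), ?_⟩)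
      (hw.nonneg i)
    dsimp only
    congr 2
    funext j
    rcases j with j | j <;> rfl

theorem IsReduction.group {V : Type u} [DecidableEq N] {P : MvPolynomial V ℝ} {m : Finset V → ℝ}
    {ι : V → N} {Q : MvPolynomial N ℝ} {E : Set (Finset N)} {m' : Finset N → ℝ}
    (h : IsReduction P m ι Q E m') {G : Finset (Finset N)} (hG : G.Nonempty) {C : Finset N}
    (hC : ∀ H ∈ G, C ⊆ H) (hpos : ∀ H ∈ G, 0 < setCoeff Q H) :
    ∃ E' m'', IsReduction P m (fun s => some (ι s)) (groupReduced Q G C) E' m'' := by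
  have hGE : ∀ H ∈ G, H ∈ E := fun H hH => mem_of_setCoeff_ne_zero h.supported (hpos H hH).ne'
  have hterm : groupReduced Q G C = rename (Function.Embedding.some : N ↪ Option N)
      (Q - ∑ H ∈ G, MvPolynomial.C (setCoeff Q H) * ∏ j ∈ H, X j) +
      ∑ H ∈ G, MvPolynomial.C (setCoeff Q H) * groupTerm C H := rfl
  refine ⟨groupEdges E G, groupMoments m' C, h.hypergraph.groupEdges hG, ?_,
    h.consistent.groupMoments hC hGE, ?_, fun y => ?_⟩
  · rw [hterm]
    refine Submodule.add_mem _ (rename_mem_supportedOn Function.Embedding.some (fun D hD => ?_)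
      (Submodule.sub_mem _ h.supported
        (Submodule.sum_mem _ fun H hH => C_mul_prod_X_mem_supportedOn (hGE H hH) _)))
      (Submodule.sum_mem _ fun H hH => ?_)
    · exact Or.inl ⟨by simp, by rwa [Finset.eraseNone_map_some]⟩
    · rw [C_mul']
      refine Submodule.smul_mem _ _ (mem_supportedOn_of_vars_subset (fun D hD => ?_)
        (vars_groupTerm_subset (hC H hH)))
      exact Or.inr ⟨H, hH, by simpa using Finset.eraseNone.monotone hD⟩
  · rw [hterm, map_add, pseudoExp_rename _ (groupMoments_map_some m' C)]
    simp only [map_sub, C_mul', map_sum, map_smul, pseudoExp_prod_X, h.value_eq, smul_eq_mul]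
    rw [sub_add, sub_eq_self, sub_eq_zero]
    refine Finset.sum_congr rfl fun H hH => ?_
    obtain ⟨Ω, _, w, x, hw⟩ := h.consistent H (hGE H hH)
    rw [(hw.groupMoments (hC H hH) (D := Finset.insertNone H) (by simp)).pseudoExp_eq
      (vars_groupTerm_subset (hC H hH)), hw.moment H subset_rfl]
    simp only [eval_groupTerm_groupPoint (hC H hH)]
  · refine (h.value_le fun s => y (Function.Embedding.some s)).trans ?_
    rw [hterm, map_add, pseudoExp_rename _
      (overwriteMoments_map Function.Embedding.some (groupMoments_map_some m' C) y)]
    simp only [map_sub, C_mul', map_sum, map_smul, pseudoExp_prod_X, smul_eq_mul]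
    rw [sub_add, le_sub_self_iff, sub_nonpos]
    -- Positivity of the coefficients turns the pointwise bound on `groupTerm` into one on the
    -- weighted terms.
    refine Finset.sum_le_sum fun H hH => mul_le_mul_of_nonneg_left ?_ (hpos H hH).le
    obtain ⟨Ω, _, w, x, hw⟩ := h.consistent H (hGE H hH)
    rw [((hw.groupMoments (hC H hH) (D := Finset.insertNone H) (by simp)).overwrite y).pseudoExp_eq
      (vars_groupTerm_subset (hC H hH)),
      (hw.overwrite fun s => y (Function.Embedding.some s)).moment H subset_rfl]
    exact Finset.sum_le_sum fun i _ => mul_le_mul_of_nonneg_left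
      (prod_le_eval_groupTerm (hC H hH) fun j => overwrite y j (groupPoint C (x i) j))
      (hw.nonneg i)

/-- The induction closes because `value_le` covers every `y` on the current variables, auxiliary
ones included: each step uses it for the restriction of the larger `y`. -/
theorem Reduces.exists_isReduction {V : Type u} {P : MvPolynomial V ℝ} {ι : V → N}
    {Q : MvPolynomial N ℝ} (hred : Reduces P N ι Q) {E : Set (Finset V)} {m : Finset V → ℝ}
    (hE : IsHypergraph E) (hP : P ∈ supportedOn E) (hm : LocallyConsistent E m) :
    ∃ E' m', IsReduction P m ι Q E' m' := by
  induction hred with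
  | refl => exact ⟨E, m, hE, hP, hm, rfl, fun y => le_rfl⟩
  | group hQ G hG C hC hpos ih =>
    obtain ⟨E', m', h⟩ := ih
    exact h.group hG hC hpos
  | clique hQ H hH g hg ih =>
    obtain ⟨E', m', h⟩ := ih
    exact h.clique hH hg

/-- Needed because the roof dual cost of `Q` records only square-free coefficients. -/
theorem Reduces.mem_restrictDegree_one {V : Type u} {P : MvPolynomial V ℝ} {ι : V → N}
    {Q : MvPolynomial N ℝ} (hred : Reduces P N ι Q) (hP : P ∈ restrictDegree V ℝ 1) :
    Q ∈ restrictDegree N ℝ 1 := by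
  have hprod : ∀ {M : Type u} (c : ℝ) (H : Finset M),
      C c * ∏ j ∈ H, X j ∈ restrictDegree M ℝ 1 := fun c H =>
    C_mul_mem_restrictDegree_one (prod_X_mem_restrictDegree_one H Function.injective_id) c
  induction hred with
  | refl => exact hP
  | group hQ G hG C hC hpos ih =>
    exact Submodule.add_mem _ (rename_mem_restrictDegree_one (Option.some_injective _)
      (Submodule.sub_mem _ ih (Submodule.sum_mem _ fun H _ => hprod _ H)))
      (Submodule.sum_mem _ fun H _ => C_mul_mem_restrictDegree_one
        (groupTerm_mem_restrictDegree_one C H) _)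
  | clique hQ H hH g hg ih =>
    exact Submodule.add_mem _ (rename_mem_restrictDegree_one Sum.inl_injective
      (Submodule.sub_mem _ ih (hprod _ H))) hg.1

end Reductions

end PseudoBoolean

namespace PseudoBoolean

open MvPolynomial

/-! ## The full local LP relaxation in terms of moments -/

section FLP

variable {N : Type u}

/-- The indicator polynomial of a labeling `x` of `C`. -/
noncomputable def cubeIndicator (C : Finset N) (x : {s : N // s ∈ C} → Bool) :
    MvPolynomial N ℝ :=
  ∏ s : {s : N // s ∈ C}, if x s then X s.1 else 1 - X s.1

theorem vars_ite_subset (b : Bool) (s : N) :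
    (if b then X s else 1 - X s : MvPolynomial N ℝ).vars ⊆ {s} := by
  classical
  split_ifs
  · simp [vars_X]
  · exact (vars_sub_subset _).trans (by simp [vars_X])

theorem vars_cubeIndicator_subset (C : Finset N) (x : {s : N // s ∈ C} → Bool) :
    (cubeIndicator C x).vars ⊆ C := by
  classical
  refine (vars_prod _).trans (Finset.biUnion_subset.2 fun s _ => ?_)
  exact (vars_ite_subset _ _).trans (Finset.singleton_subset_iff.2 s.2)

theorem cubeIndicator_mem_restrictDegree_one (C : Finset N) (x : {s : N // s ∈ C} → Bool) :
    cubeIndicator C x ∈ restrictDegree N ℝ 1 := by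
  refine prod_mem_restrictDegree_one _ _ (fun s _ => ?_) fun a _ b _ hab => ?_
  · split_ifs
    · exact X_mem_restrictDegree_one _
    · exact Submodule.sub_mem _ one_mem_restrictDegree_one (X_mem_restrictDegree_one _)
  · refine Disjoint.mono (vars_ite_subset _ _) (vars_ite_subset _ _) ?_
    simpa using fun h => hab (Subtype.ext h)

theorem eval_cubeIndicator (C : Finset N) (x : {s : N // s ∈ C} → Bool) (z : N → Bool) :
    eval (boolVec z) (cubeIndicator C x) = if ∀ s, z s.1 = x s then 1 else 0 := by
  rw [cubeIndicator, eval_prod]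
  split_ifs with h
  · refine Finset.prod_eq_one fun s _ => ?_
    have := h s
    cases hx : x s <;> simp_all [boolVec]
  · push Not at h
    obtain ⟨s, hs⟩ := h
    refine Finset.prod_eq_zero (Finset.mem_univ s) ?_
    cases hx : x s <;> simp_all [boolVec]

/-- The vector of the local probabilities of the moments `m`. -/
noncomputable def momentVec (E : Finset (Finset N)) (m : Finset N → ℝ) : IndexedVec E :=
  fun C x => pseudoExp m (cubeIndicator C.1 x)

theorem IsMomentsOn.pseudoExp_cubeIndicator {Ω : Type u} [Fintype Ω] {m : Finset N → ℝ}
    {C : Finset N} {w : Ω → ℝ} {x : Ω → N → Bool} (h : IsMomentsOn m C w x) {D : Finset N}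
    (hD : D ⊆ C) (z : {s : N // s ∈ D} → Bool) :
    pseudoExp m (cubeIndicator D z) = ∑ i, if ∀ s, x i s.1 = z s then w i else 0 := by
  rw [h.pseudoExp_eq ((vars_cubeIndicator_subset D z).trans hD)]
  simp [eval_cubeIndicator]

theorem mem_of_mem_termEdges [Fintype N] {Q : MvPolynomial N ℝ} {E : Set (Finset N)} (hE : IsHypergraph E)
    (hQ : Q ∈ supportedOn E) {C : Finset N} (hC : C ∈ termEdges Q) : C ∈ E := by
  simp only [termEdges, Finset.mem_filter, Finset.mem_univ, true_and] at hC
  rcases hC with h | h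
  · rcases Nat.le_one_iff_eq_zero_or_eq_one.1 h with h | h
    · exact Finset.card_eq_zero.1 h ▸ hE.empty
    · obtain ⟨s, rfl⟩ := Finset.card_eq_one.1 h
      exact hE.singleton s
  · exact mem_of_setCoeff_ne_zero hQ h

theorem empty_mem_termEdges [Fintype N] (Q : MvPolynomial N ℝ) : ∅ ∈ termEdges Q := by
  simp [termEdges]

variable [DecidableEq N]

/-- The distribution chosen for `C` also computes the moments on every `D ⊆ C`, so the distributions
chosen for different edges need no further compatibility. -/
theorem momentVec_mem_flp {E : Finset (Finset N)} {E' : Set (Finset N)} {m : Finset N → ℝ}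
    (hm : LocallyConsistent E' m) (hE : ∀ C ∈ E, C ∈ E') : momentVec E m ∈ flp E := by
  refine ⟨fun C z => ?_, fun C hC z => ?_, fun C D h z => ?_⟩ <;>
    obtain ⟨Ω, _, w, x, hw⟩ := hm C.1 (hE _ C.2)
  · rw [momentVec, hw.pseudoExp_cubeIndicator subset_rfl]
    refine Finset.sum_nonneg fun i _ => ?_
    split_ifs
    exacts [hw.nonneg i, le_rfl]
  · rw [momentVec, hw.pseudoExp_cubeIndicator subset_rfl, ← hw.sum_eq_one]
    refine Finset.sum_congr rfl fun i _ => if_pos fun s => ?_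
    have := s.2
    simp [hC] at this
  · simp only [momentVec, hw.pseudoExp_cubeIndicator h.1, hw.pseudoExp_cubeIndicator subset_rfl]
    rw [← Finset.sum_filter, Finset.sum_comm]
    refine Finset.sum_congr rfl fun i _ => ?_
    rw [Finset.sum_filter, Finset.sum_eq_single fun s : {s : N // s ∈ C.1} => x i s.1]
    · simp
    · intro b _ hb
      have hb' : ¬ ∀ s : {s : N // s ∈ C.1}, x i s.1 = b s :=
        fun h' => hb (funext fun s => (h' s).symm)
      rw [if_neg hb', ite_self]
    · simp

theorem sum_eq_of_mem_flp {E : Finset (Finset N)} {μ : IndexedVec E} (hμ : μ ∈ flp E)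
    (C D : {C : Finset N // C ∈ E}) (h : D.1 ⊆ C.1) (z : {s : N // s ∈ D.1} → Bool) :
    (∑ x : {s : N // s ∈ C.1} → Bool,
      if (∀ s : {s : N // s ∈ D.1}, x ⟨s.1, h s.2⟩ = z s) then μ C x else 0) = μ D z := by
  rcases h.eq_or_ssubset with h' | h'
  · obtain rfl : D = C := Subtype.ext h'
    rw [Finset.sum_eq_single z]
    · simp
    · intro b _ hb
      exact if_neg fun h'' => hb (funext fun s => h'' s)
    · simp
  · exact hμ.2.2 C D h' z

theorem sum_eq_one_of_mem_flp {E : Finset (Finset N)} (hE : ∅ ∈ E) {μ : IndexedVec E}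
    (hμ : μ ∈ flp E) (C : {C : Finset N // C ∈ E}) : ∑ x, μ C x = 1 := by
  rw [← hμ.2.1 ⟨∅, hE⟩ rfl fun s => false,
    ← sum_eq_of_mem_flp hμ C ⟨∅, hE⟩ (Finset.empty_subset _) fun s => false]
  refine Finset.sum_congr rfl fun x _ => (if_pos ?_).symm
  rintro ⟨s, hs⟩
  simp at hs

/-- The moments of a relaxed labeling. -/
noncomputable def flpMoments {E : Finset (Finset N)} (μ : IndexedVec E) (D : Finset N) : ℝ :=
  if h : D ∈ E then μ ⟨D, h⟩ fun _ => true else 0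

/-- The extension by `false` of a labeling of `C`. -/
def extendLabeling (C : Finset N) (x : {s : N // s ∈ C} → Bool) (s : N) : Bool :=
  if h : s ∈ C then x ⟨s, h⟩ else false

theorem extendLabeling_apply (C : Finset N) (x : {s : N // s ∈ C} → Bool) (s : N) (hs : s ∈ C) :
    extendLabeling C x s = x ⟨s, hs⟩ := dif_pos hs

/-- The distribution on `C` is `μ C` itself; marginalization identifies the probability of all ones
on `D` with `μ_D(1,…,1)`. -/
theorem isMomentsOn_flpMoments {E : Finset (Finset N)} (hE : ∅ ∈ E)
    (hsub : ∀ C ∈ E, ∀ D : Finset N, D ⊆ C → D ∈ E) {μ : IndexedVec E} (hμ : μ ∈ flp E)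
    (C : {C : Finset N // C ∈ E}) :
    IsMomentsOn (flpMoments μ) C.1 (μ C) (extendLabeling C.1) := by
  refine ⟨hμ.1 C, sum_eq_one_of_mem_flp hE hμ C, fun D hD => ?_⟩
  have hDE := hsub C.1 C.2 D hD
  rw [flpMoments, dif_pos hDE, ← sum_eq_of_mem_flp hμ C ⟨D, hDE⟩ hD]
  refine Finset.sum_congr rfl fun x _ => ?_
  rw [prod_boolVec_eq_ite, mul_ite, mul_one, mul_zero]
  refine if_congr ⟨fun h j hj => ?_, fun h s => ?_⟩ rfl rfl
  · rw [extendLabeling_apply _ _ _ (hD hj)]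
    exact h ⟨j, hj⟩
  · rw [← h s.1 s.2, extendLabeling_apply]

theorem momentVec_flpMoments {E : Finset (Finset N)} (hE : ∅ ∈ E)
    (hsub : ∀ C ∈ E, ∀ D : Finset N, D ⊆ C → D ∈ E) {μ : IndexedVec E} (hμ : μ ∈ flp E) :
    momentVec E (flpMoments μ) = μ := by
  funext C z
  rw [momentVec, (isMomentsOn_flpMoments hE hsub hμ C).pseudoExp_cubeIndicator subset_rfl,
    Finset.sum_eq_single z]
  · exact if_pos fun s => extendLabeling_apply _ _ _ s.2
  · intro b _ hb
    refine if_neg fun h => hb (funext fun s => ?_)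
    rw [← h s, extendLabeling_apply _ _ _ s.2]
  · simp

theorem momentVec_overwriteMoments_flpMoments {E : Finset (Finset N)} (hE : ∅ ∈ E)
    (hsub : ∀ C ∈ E, ∀ D : Finset N, D ⊆ C → D ∈ E) {μ : IndexedVec E} (hμ : μ ∈ flp E)
    (y : N → Option Bool) :
    momentVec E (overwriteMoments y (flpMoments μ)) = linExt (overwrite y) μ := by
  funext C z
  rw [momentVec, ((isMomentsOn_flpMoments hE hsub hμ C).overwrite y).pseudoExp_cubeIndicator
    subset_rfl, linExt]
  refine Finset.sum_congr rfl fun x _ => ?_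
  have : ∀ s : {s : N // s ∈ C.1}, extendLabeling C.1 x s.1 = x s :=
    fun s => extendLabeling_apply _ _ _ s.2
  simp only [this]

theorem scalarProd_momentVec {E : Finset (Finset N)} (f : IndexedVec E) (m : Finset N → ℝ) :
    scalarProd f (momentVec E m) =
      pseudoExp m (∑ C : {C : Finset N // C ∈ E}, ∑ x, f C x • cubeIndicator C.1 x) := by
  simp only [scalarProd, momentVec, map_sum, map_smul, smul_eq_mul]

theorem eq_sum_cubeIndicator [Finite N] {E : Finset (Finset N)} {f : IndexedVec E}
    {P : MvPolynomial N ℝ} (hP : P ∈ restrictDegree N ℝ 1)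
    (hPf : ∀ x : N → Bool, eval (boolVec x) P = energy f x) :
    P = ∑ C : {C : Finset N // C ∈ E}, ∑ x, f C x • cubeIndicator C.1 x := by
  refine eq_of_eval_boolVec_eq hP (Submodule.sum_mem _ fun C _ => Submodule.sum_mem _ fun x _ =>
    Submodule.smul_mem _ _ (cubeIndicator_mem_restrictDegree_one _ _)) fun z => ?_
  rw [hPf, energy, map_sum]
  refine Finset.sum_congr rfl fun C _ => ?_
  rw [map_sum, Finset.sum_eq_single fun s : {s : N // s ∈ C.1} => z s.1]
  · simp [smul_eval, eval_cubeIndicator]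
  · intro b _ hb
    rw [smul_eval, eval_cubeIndicator, if_neg fun h => hb (funext fun s => (h s).symm), mul_zero]
  · simp

theorem sum_cubeIndicator_mem_supportedOn {E : Finset (Finset N)}
    (hsub : ∀ C ∈ E, ∀ D : Finset N, D ⊆ C → D ∈ E) (f : IndexedVec E) :
    ∑ C : {C : Finset N // C ∈ E}, ∑ x, f C x • cubeIndicator C.1 x ∈
      supportedOn (E : Set (Finset N)) :=
  Submodule.sum_mem _ fun C _ => Submodule.sum_mem _ fun _ _ => Submodule.smul_mem _ _
    (mem_supportedOn_of_vars_subset (fun D hD => hsub C.1 C.2 D hD)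
      (vars_cubeIndicator_subset _ _))

theorem scalarProd_add_smul {E : Finset (Finset N)} (f μ δ : IndexedVec E) (ε : ℝ) :
    scalarProd f (fun C x => μ C x + ε * δ C x) = scalarProd f μ + ε * scalarProd f δ := by
  simp only [scalarProd, Finset.mul_sum, ← Finset.sum_add_distrib]
  exact Finset.sum_congr rfl fun C _ => Finset.sum_congr rfl fun x _ => by ring

/-- Optimality of `μ` controls every feasible direction `ν - ν'` between relaxed labelings. -/
theorem scalarProd_le_of_isMin {E : Finset (Finset N)} {f μ ν ν' : IndexedVec E}
    (hμ : μ ∈ flp E) (hν : ν ∈ flp E) (hν' : ν' ∈ flp E)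
    (hmin : ∀ ρ ∈ flp E, scalarProd f μ ≤ scalarProd f ρ)
    (h : ∀ C x, μ C x = 0 → ν' C x ≤ ν C x) : scalarProd f ν' ≤ scalarProd f ν := by
  -- For small `ε > 0` the point `μ + ε (ν - ν')` stays nonnegative: by `h` where `μ` vanishes, by
  -- continuity elsewhere.
  have hev : ∀ᶠ ε : ℝ in nhdsWithin 0 (Set.Ioi 0),
      ∀ C x, 0 ≤ μ C x + ε * (ν C x - ν' C x) := by
    refine Filter.eventually_all.2 fun C => Filter.eventually_all.2 fun x => ?_
    rcases (hμ.1 C x).eq_or_lt with h0 | hpos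
    · filter_upwards [self_mem_nhdsWithin] with ε hε
      rw [← h0, zero_add]
      exact mul_nonneg (le_of_lt hε) (sub_nonneg.2 (h C x h0.symm))
    · have ht : Filter.Tendsto (fun ε : ℝ => μ C x + ε * (ν C x - ν' C x)) (nhds 0)
          (nhds (μ C x + 0 * (ν C x - ν' C x))) :=
        Continuous.tendsto (by fun_prop) 0
      rw [zero_mul, add_zero] at ht
      filter_upwards [nhdsWithin_le_nhds (ht.eventually (lt_mem_nhds hpos))] with ε hε
      exact hε.le
  obtain ⟨ε, hε, hε0⟩ := (hev.and self_mem_nhdsWithin).exists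
  have hmem : (fun C x => μ C x + ε * (ν C x - ν' C x)) ∈ flp E := by
    refine ⟨hε, fun C hC x => ?_, fun C D hCD z => ?_⟩ <;> dsimp only
    · rw [hμ.2.1 C hC, hν.2.1 C hC, hν'.2.1 C hC]
      ring
    · rw [← hμ.2.2 C D hCD, ← hν.2.2 C D hCD, ← hν'.2.2 C D hCD, ← Finset.sum_sub_distrib,
        Finset.mul_sum, ← Finset.sum_add_distrib]
      refine Finset.sum_congr rfl fun x _ => ?_
      split_ifs <;> simp
  have hle := hmin _ hmem
  rw [scalarProd_add_smul f μ (fun C x => ν C x - ν' C x)] at hle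
  have hsub : scalarProd f (fun C x => ν C x - ν' C x) = scalarProd f ν - scalarProd f ν' := by
    simp only [scalarProd, ← Finset.sum_sub_distrib, mul_sub]
  rw [hsub] at hle
  have hε0' : 0 < ε := hε0
  have := nonneg_of_mul_nonneg_right (by linarith : 0 ≤ ε * (scalarProd f ν - scalarProd f ν')) hε0'
  linarith

/-! ## Quadratic problems -/

theorem eq_setExp_of_mem_support {Q : MvPolynomial N ℝ} (hQ : Q ∈ restrictDegree N ℝ 1)
    {e : N →₀ ℕ} (he : e ∈ Q.support) : e = setExp e.support := by
  ext i
  have := (mem_restrictDegree _ _ _).1 hQ e he i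
  rw [setExp_apply]
  split_ifs with h
  · have := Finsupp.mem_support_iff.1 h
    omega
  · exact Finsupp.notMem_support_iff.1 h

variable [Fintype N]

theorem pseudoExp_eq_sum_setCoeff {Q : MvPolynomial N ℝ} (hQ : Q ∈ restrictDegree N ℝ 1)
    (m : Finset N → ℝ) : pseudoExp m Q = ∑ C ∈ termEdges Q, setCoeff Q C * m C := by
  conv_lhs => rw [Q.as_sum]
  simp only [map_sum, pseudoExp_monomial]
  refine Finset.sum_bij_ne_zero (fun e _ _ => e.support) (fun e he _ => ?_)
    (fun e he _ e' he' _ h => ?_) (fun C hC h => ?_) fun e he _ => ?_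
  · simp only [termEdges, Finset.mem_filter, Finset.mem_univ, true_and]
    rw [setCoeff, ← eq_setExp_of_mem_support hQ he]
    exact Or.inr (mem_support_iff.1 he)
  · rw [eq_setExp_of_mem_support hQ he, eq_setExp_of_mem_support hQ he', h]
  · refine ⟨setExp C, mem_support_iff.2 fun h0 => h ?_, ?_, support_setExp C⟩
    · rw [setCoeff, h0, zero_mul]
    · rwa [support_setExp]
  · rw [setCoeff, ← eq_setExp_of_mem_support hQ he]

/-- `termCost` vanishes except at the all-ones labeling, whose indicator is the monomial itself. -/
theorem scalarProd_termCost_momentVec {Q : MvPolynomial N ℝ} (hQ : Q ∈ restrictDegree N ℝ 1)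
    (m : Finset N → ℝ) :
    scalarProd (termCost Q) (momentVec (termEdges Q) m) = pseudoExp m Q := by
  rw [pseudoExp_eq_sum_setCoeff hQ, ← Finset.sum_coe_sort, scalarProd]
  refine Finset.sum_congr rfl fun C _ => ?_
  rw [Finset.sum_eq_single fun _ => true]
  · have : cubeIndicator C.1 (fun _ => true) = ∏ j ∈ C.1, (X j : MvPolynomial N ℝ) := by
      simp only [cubeIndicator, if_true]
      exact Finset.prod_coe_sort C.1 fun j => (X j : MvPolynomial N ℝ)
    simp [momentVec, this, pseudoExp_prod_X, termCost, boolVec]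
  · intro b _ hb
    obtain ⟨s, hs⟩ := Function.ne_iff.1 hb
    rw [termCost, Finset.prod_eq_zero (Finset.mem_univ s), mul_zero, zero_mul]
    simpa [boolVec] using hs
  · simp

theorem card_le_two_of_mem_termEdges {Q : MvPolynomial N ℝ} (hQ : Q.totalDegree ≤ 2)
    {C : Finset N} (hC : C ∈ termEdges Q) : C.card ≤ 2 := by
  simp only [termEdges, Finset.mem_filter, Finset.mem_univ, true_and] at hC
  rcases hC with h | h
  · omega
  · refine le_trans ?_ ((le_totalDegree (mem_support_iff.2 h)).trans hQ)
    rw [Finsupp.sum, support_setExp, Finset.card_eq_sum_ones]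
    exact Finset.sum_le_sum fun j hj => by rw [setExp_apply, if_pos hj]

/-- If an edge `C` of a relaxed labeling has at most one node whose marginal is not integer, then
the labelings of `C` that agree with the integer part have positive weight. -/
theorem pos_of_agree {Q : MvPolynomial N ℝ} {μ : IndexedVec (termEdges Q)}
    (hμ : μ ∈ flp (termEdges Q)) {y : N → Option Bool}
    (hy : ∀ (s : N) (b : Bool),
      y s = some b ↔ μ ⟨{s}, singleton_mem_termEdges Q s⟩ (fun _ => b) = 1)
    (C : {C : Finset N // C ∈ termEdges Q}) (t : {s : N // s ∈ C.1})
    (ht : ∀ s ∈ C.1, y s = none → s = t.1) (x : {s : N // s ∈ C.1} → Bool)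
    (hx : ∀ s b, y s.1 = some b → x s = b) : 0 < μ C x := by
  have hmarg : ∀ (s : {s : N // s ∈ C.1}) (b : Bool),
      (∑ z, if z s = b then μ C z else 0) =
        μ ⟨{s.1}, singleton_mem_termEdges Q s.1⟩ (fun _ => b) := fun s b => by
    rw [← sum_eq_of_mem_flp hμ C ⟨{s.1}, singleton_mem_termEdges Q s.1⟩
      (Finset.singleton_subset_iff.2 s.2)]
    refine Finset.sum_congr rfl fun z _ => if_congr ⟨?_, fun h => h ⟨s.1, by simp⟩⟩ rfl rfl
    rintro h ⟨s', hs'⟩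
    obtain rfl := Finset.mem_singleton.1 hs'
    exact h
  have hadd : ∀ (s : {s : N // s ∈ C.1}) (b : Bool),
      (∑ z, if z s = b then μ C z else 0) + (∑ z, if z s = !b then μ C z else 0) = 1 :=
    fun s b => by
      rw [← Finset.sum_add_distrib, ← sum_eq_one_of_mem_flp (empty_mem_termEdges Q) hμ C]
      refine Finset.sum_congr rfl fun z _ => ?_
      cases z s <;> cases b <;> simp
  have hnonneg : ∀ (s : {s : N // s ∈ C.1}) (b : Bool) z, 0 ≤ if z s = b then μ C z else 0 :=
    fun s b z => by split_ifs; exacts [hμ.1 C z, le_rfl]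
  have hzero : ∀ (s : {s : N // s ∈ C.1}) b z, y s.1 = some b → z s ≠ b → μ C z = 0 :=
    fun s b z hs hz => by
      have h1 := hadd s b
      rw [hmarg s b, (hy s.1 b).1 hs] at h1
      have h2 := (Finset.sum_eq_zero_iff_of_nonneg fun z _ => hnonneg s (!b) z).1
        (by linarith) z (Finset.mem_univ z)
      rwa [if_pos (by revert hz; cases z s <;> cases b <;> simp)] at h2
  -- Otherwise the marginal of `t` would be concentrated on `!x t`, making `t` integral with a value
  -- that `hx` forbids.
  have hpos : 0 < ∑ z, if z t = x t then μ C z else 0 := by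
    refine lt_of_le_of_ne (Finset.sum_nonneg fun z _ => hnonneg t _ z) fun h0 => ?_
    have h1 := hadd t (x t)
    rw [← h0, zero_add, hmarg] at h1
    have h2 := hx t _ ((hy t.1 (!(x t))).2 h1)
    cases h : x t <;> simp [h] at h2
  obtain ⟨z, -, hz⟩ := Finset.exists_ne_zero_of_sum_ne_zero hpos.ne'
  have hzt : z t = x t := by
    by_contra h
    simp [h] at hz
  rw [if_pos hzt] at hz
  -- A labeling of nonzero weight carries the prescribed value at each integral node, and `t` is the
  -- only possible other one.
  have : z = x := by
    funext s
    rcases hs : y s.1 with _ | b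
    · rw [Subtype.ext (ht s.1 s.2 hs), hzt]
    · rw [hx s b hs]
      by_contra h
      exact hz (hzero s b z hs h)
  exact this ▸ lt_of_le_of_ne (hμ.1 C z) hz.symm

theorem IsQPBOPersistency.pseudoExp_le {Q : MvPolynomial N ℝ} (hQ1 : Q ∈ restrictDegree N ℝ 1)
    (hQ2 : Q.totalDegree ≤ 2) {y : N → Option Bool} (hy : IsQPBOPersistency Q y)
    {E : Set (Finset N)} (hE : IsHypergraph E) (hQE : Q ∈ supportedOn E) {m : Finset N → ℝ}
    (hm : LocallyConsistent E m) : pseudoExp (overwriteMoments y m) Q ≤ pseudoExp m Q := by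
  obtain ⟨μ, hμ, hmin, hμy⟩ := hy
  have hsub : ∀ C ∈ termEdges Q, C ∈ E := fun C hC => mem_of_mem_termEdges hE hQE hC
  rw [← scalarProd_termCost_momentVec hQ1, ← scalarProd_termCost_momentVec hQ1]
  refine scalarProd_le_of_isMin hμ (momentVec_mem_flp hm hsub)
    (momentVec_mem_flp (hm.overwrite y) hsub) hmin fun C z hz => ?_
  obtain ⟨Ω, _, w, x, hw⟩ := hm C.1 (hsub _ C.2)
  rw [momentVec, momentVec, hw.pseudoExp_cubeIndicator subset_rfl,
    (hw.overwrite y).pseudoExp_cubeIndicator subset_rfl]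
  refine Finset.sum_le_sum fun i _ => ?_
  by_cases hov : ∀ s : {s : N // s ∈ C.1}, overwrite y s.1 (x i s.1) = z s
  · rw [if_pos hov]
    by_cases hx : ∀ s : {s : N // s ∈ C.1}, x i s.1 = z s
    · rw [if_pos hx]
    -- A sample point that overwriting moves onto `z` was changed at an integral node `s`. At most
    -- one node of `C` is then fractional and `z` agrees with `y`, so `μ C z > 0`, against `hz`.
    · exfalso
      push Not at hx
      obtain ⟨s, hs⟩ := hx
      have hys : y s.1 ≠ none := fun h => hs (by simpa [overwrite, h] using hov s)
      obtain ⟨t, ht⟩ : ∃ t : {s : N // s ∈ C.1}, ∀ r ∈ C.1, y r = none → r = t.1 := by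
        have hcard : (C.1.erase s.1).card ≤ 1 := by
          rw [Finset.card_erase_of_mem s.2]
          have := card_le_two_of_mem_termEdges hQ2 C.2
          omega
        by_cases hne : ∃ t ∈ C.1, y t = none
        · obtain ⟨t, htC, hty⟩ := hne
          refine ⟨⟨t, htC⟩, fun r hr hyr => Finset.card_le_one.1 hcard _ ?_ _ ?_⟩
          · exact Finset.mem_erase.2 ⟨by rintro rfl; exact hys hyr, hr⟩
          · exact Finset.mem_erase.2 ⟨by rintro rfl; exact hys hty, htC⟩
        -- Without fractional nodes the choice of `t` is immaterial.
        · exact ⟨s, fun r hr hyr => (hne ⟨r, hr, hyr⟩).elim⟩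
      refine (pos_of_agree hμ hμy C t ht z fun r b hr => ?_).ne' hz
      rw [← hov r]
      simp [overwrite, hr]
  · rw [if_neg hov]
    split_ifs
    exacts [hw.nonneg i, le_rfl]

end FLP

end PseudoBoolean

open PseudoBoolean in
theorem mainTheorem10 {V : Type u} [Fintype V] [DecidableEq V]
    (E : Finset (Finset V)) (hE_empty : ∅ ∈ E) (hE_node : ∀ s : V, {s} ∈ E)
    (hE_sub : ∀ C ∈ E, ∀ D : Finset V, D ⊆ C → D ∈ E)
    (f : PseudoBoolean.IndexedVec E)
    (P : MvPolynomial V ℝ) (hP : P ∈ MvPolynomial.restrictDegree V ℝ 1)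
    (hPf : ∀ x : V → Bool,
      MvPolynomial.eval (PseudoBoolean.boolVec x) P = PseudoBoolean.energy f x)
    {N : Type u} [Fintype N] [DecidableEq N] (ι : V → N) (Q : MvPolynomial N ℝ)
    (hred : PseudoBoolean.Reduces P N ι Q) (hQ : Q.totalDegree ≤ 2)
    (y : N → Option Bool) (hy : PseudoBoolean.IsQPBOPersistency Q y) :
    PseudoBoolean.IsFLPImproving f (PseudoBoolean.overwrite fun s => y (ι s)) := by
  intro μ hμ
  have hPE := eq_sum_cubeIndicator hP hPf
  obtain ⟨E', m', h⟩ := hred.exists_isReduction (E := (E : Set (Finset V))) (m := flpMoments μ)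
    ⟨hE_empty, hE_sub, hE_node⟩ (hPE ▸ sum_cubeIndicator_mem_supportedOn hE_sub f)
    fun C hC => ⟨_, _, _, _, isMomentsOn_flpMoments hE_empty hE_sub hμ ⟨C, hC⟩⟩
  have hle := hy.pseudoExp_le (hred.mem_restrictDegree_one hP) hQ h.hypergraph h.supported
    h.consistent
  -- Overwritten `P` ≤ overwritten `Q` ≤ `Q` = `P`, evaluated at the moments of `μ` and their
  -- extension.
  have hval := (h.value_le y).trans (hle.trans_eq h.value_eq)
  rw [hPE, ← scalarProd_momentVec, ← scalarProd_momentVec,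
    momentVec_overwriteMoments_flpMoments hE_empty hE_sub hμ,
    momentVec_flpMoments hE_empty hE_sub hμ] at hval
  exact hval
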